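/- For a positive integer $n$ let $Q_n$ be the $n$-dimensional hypercube: the graph on $\{0,1\}^n$ in which two vertices are adjacent iff they differ in exactly one coordinate. Let $B_1(v)$ denote the subgraph of $Q_n$ induced by $v$ and its neighbours. Colourings $\chi$ of a graph $G$ and $\lambda$ of a graph $H$ are equivalent, written $\chi\cong\lambda$, if there is a graph isomorphism $\varphi:G\to H$ with $\chi=\lambda\circ\varphi$. A colouring $\chi$ of the vertices of $Q_n$ is $1$-distinguishable if every colouring $\lambda$ of $V(Q_n)$, for which there is a bijection $f:V(Q_n)\to V(Q_n)$ with $\chi|_{B_1(v)}\cong\lambda|_{B_1(f(v))}$ for all $v\in V(Q_n)$, satisfies $\lambda\cong\chi$; in other words, $\chi$ is determined up to automorphisms of $Q_n$ by the multiset of its coloured $1$-balls (up to isomorphism). A random $q$-colouring of $Q_n$ assigns to each vertex, independently, a uniformly random colour from $\{1,\dots,q\}$. **Theorem 1.5.** There is a constant $K>0$ such that the following holds. Let $q=q(n)$ be any sequence of positive integers with $q(n)\ge n^{2+K/\sqrt{\log n}}$ for all sufficiently large $n$, and let $\chi$ be a random $q(n)$-colouring of $Q_n$. Then $$\mathbb{P}\left[\chi\text{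 is }1\text{-distinguishable}\right]\to 1\qquad\text{as } n\to\infty .$$ -/

import Mathlib

open Filter Topology MeasureTheory ProbabilityTheory

/-- The `n`-dimensional hypercube `Q_n`: the vertices are the 0/1-vectors of length `n`, and two of
them are adjacent if they differ in exactly one coordinate. -/
def hypercube (n : ℕ) : SimpleGraph (Fin n → Bool) where
  Adj u v := hammingDist u v = 1
  symm := ⟨fun u v h => by rwa [hammingDist_comm]⟩
  loopless := ⟨fun u h => by simp at h⟩

/-- A colouring `χ` of `G` and a colouring `ψ` of `H` are equivalent if some graph isomorphism
from `G` to `H` carries `χ` to `ψ`. -/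
def ColouringEquiv {V W C : Type*} (G : SimpleGraph V) (H : SimpleGraph W)
    (χ : V → C) (ψ : W → C) : Prop :=
  ∃ f : G ≃g H, ∀ v, ψ (f v) = χ v

/-- The vertices at graph distance at most `r` from `v` (`edist` is infinite between different
components). -/
def ballVertices {V : Type*} (G : SimpleGraph V) (r : ℕ) (v : V) : Set V :=
  {w | G.edist v w ≤ (r : ℕ∞)}

/-- The `r`-ball around `v`: the subgraph induced by the vertices at distance at most `r`. -/
def ballGraph {V : Type*} (G : SimpleGraph V) (r : ℕ) (v : V) :
    SimpleGraph (ballVertices G r v) :=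
  G.induce (ballVertices G r v)

/-- The colouring of the `r`-ball around `v` obtained by restricting `χ`. -/
def ballColouring {V C : Type*} (G : SimpleGraph V) (r : ℕ) (χ : V → C) (v : V) :
    ballVertices G r v → C :=
  fun w => χ w

/-- Two colourings of `G` are `r`-locally equivalent if there is a bijection of the vertices such
that corresponding coloured `r`-balls are equivalent, i.e. if the two multisets of coloured
`r`-balls (up to isomorphism) agree. -/
def LocallyEquiv {V C : Type*} (G : SimpleGraph V) (r : ℕ) (χ ψ : V → C) : Prop :=
  ∃ f : V ≃ V, ∀ v, ColouringEquiv (ballGraph G r v) (ballGraph G r (f v))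
    (ballColouring G r χ v) (ballColouring G r ψ (f v))

/-- `χ` is `r`-distinguishable if every colouring that is `r`-locally equivalent to `χ` is
equivalent to `χ`. -/
def Distinguishable {V C : Type*} (G : SimpleGraph V) (r : ℕ) (χ : V → C) : Prop :=
  ∀ ψ : V → C, LocallyEquiv G r χ ψ → ColouringEquiv G G χ ψ

/-- The law of a random `q`-colouring of `Q_n`: the colours of the vertices are independent and
each is uniformly distributed on the `q` colours. -/
noncomputable def randomColouring (n q : ℕ) : Measure ((Fin n → Bool) → Fin q) :=
  Measure.pi fun _ => uniformOn Set.univ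

/-!
Let `f` be a bijection matching the coloured `1`-balls of `χ` with those of `ψ`, and let `H` be the
pullback of the hypercube `G` along `f`, a second hypercube on the same vertices. Isomorphisms of
`1`-balls fix centres (`ballGraph_iso_centre`), so `ψ ∘ f = χ` and every vertex sees the same set
of `χ`-colours in `G` and in `H` (`sameNeighborColours_comap`). It remains to prove that with high
probability this forces `H = G`, simultaneously for all `H`; then `f` is an automorphism carrying
`χ` to `ψ`.

The randomness enters through one first-moment bound (`card_hasRepeats_le`): the probability that
some `r` vertices of `B` repeat colours of vertices of `A` is at most `2 ^ |B| * (|A| / q) ^ r`.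
If `q ≥ M n ^ 2` with `M` a large constant, the union bound excludes, with high probability,
* order `n ^ 2` repetitions inside the neighbourhood of any set `U` of `n` vertices (there are at
  most `2 ^ (n ^ 2)` such sets);
* `n / 2` vertices adjacent to some `u` that repeat colours found within distance two of some `t`.

The hypothesis on `q` gives `q / n ^ 2 ≥ exp (√(log n)) → ∞` already for `K = 1`.

Given these two properties the rest is deterministic. Let `U` be the `H`-neighbourhood of `v`. If
`u ∈ U`, and `x` is a `G`-neighbour of `u` whose colour occurs nowhere else in the neighbourhood of
`U`, then `x` has the colour of some `H`-neighbour `w` of `u`; if `w ≠ v`, then `w` has another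
`H`-neighbour `u'` in `U`, which must see that colour in `G` too, so `x` is a common `G`-neighbour
of `u` and `u'`. Hence almost all pairs in `U` are at `G`-distance two
(`card_sdiff_le_card_close`). Since three vertices pairwise at distance two have a common
neighbour, some `x` is `G`-adjacent to a third of `U` or so, and then to most of `U`
(`exists_large_inter`). The second property shows first that `x = v`, so that the two
neighbourhoods of any vertex mostly agree, and then that an `H`-edge outside `G` cannot exist
(`adj_of_not_hasRepeats`).
-/

/-! ### The local structure of the hypercube -/

/-- The vertex obtained from `v` by changing coordinate `i`. -/
def flipAt {n : ℕ} (i : Fin n) (v : Fin n → Bool) : Fin n → Bool :=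
  fun j => if j = i then !(v j) else v j

theorem hypercube_adj_iff {n : ℕ} (u v : Fin n → Bool) :
    (hypercube n).Adj u v ↔ ∃ i, v = flipAt i u := by
  change hammingDist u v = 1 ↔ _
  unfold hammingDist
  rw [Finset.card_eq_one]
  refine exists_congr fun i => ?_
  constructor
  · intro h
    funext j
    have hj := Finset.ext_iff.1 h j
    simp only [Finset.mem_filter, Finset.mem_univ, true_and, Finset.mem_singleton] at hj
    unfold flipAt
    split_ifs with hji
    · have := hj.2 hji
      revert this
      cases u j <;> cases v j <;> simp
    · by_contra hne
      exact hji (hj.1 (Ne.symm hne))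
  · rintro rfl
    ext j
    by_cases hji : j = i <;> simp [flipAt, hji]

theorem flipAt_flipAt {n : ℕ} (i : Fin n) (v : Fin n → Bool) : flipAt i (flipAt i v) = v := by
  funext j
  by_cases h : j = i <;> simp [flipAt, h]

theorem flipAt_comm {n : ℕ} (i j : Fin n) (v : Fin n → Bool) :
    flipAt i (flipAt j v) = flipAt j (flipAt i v) := by
  funext k
  simp only [flipAt]
  split_ifs <;> rfl

theorem flipAt_injective {n : ℕ} (v : Fin n → Bool) :
    Function.Injective fun i => flipAt i v := by
  intro i j h
  have := congrFun h i
  by_contra hij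
  simp [flipAt, hij] at this

theorem eq_or_eq_of_flipAt {n : ℕ} {u : Fin n → Bool} {a b c d : Fin n} (hab : a ≠ b)
    (h : flipAt c u = flipAt d (flipAt b (flipAt a u))) : c = a ∨ c = b := by
  have h1 := congrFun h a
  have h2 := congrFun h b
  simp only [flipAt] at h1 h2
  grind

/-- Regularity of degree `n`, together with the property that two vertices with a common neighbour
have exactly two common neighbours. -/
structure IsZeroTwoGraph {V : Type*} [Fintype V] (G : SimpleGraph V) [DecidableRel G.Adj]
    (n : ℕ) : Prop where
  card_neighborFinset : ∀ v, (G.neighborFinset v).card = n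
  eq_of_common : ∀ u v x y z, u ≠ v → G.Adj u x → G.Adj v x → G.Adj u y → G.Adj v y →
    G.Adj u z → G.Adj v z → x ≠ z → y ≠ z → x = y
  exists_common : ∀ u v w, v ≠ w → G.Adj u v → G.Adj u w →
    ∃ u', u' ≠ u ∧ G.Adj u' v ∧ G.Adj u' w

/-- Two distinct vertices are close if they have a common neighbour; in the hypercube this says
that their distance is two. -/
def Close {V : Type*} (G : SimpleGraph V) (u v : V) : Prop :=
  u ≠ v ∧ ∃ x, G.Adj u x ∧ G.Adj v x

theorem hypercube_isZeroTwoGraph (n : ℕ) [DecidableRel (hypercube n).Adj] :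
    IsZeroTwoGraph (hypercube n) n where
  card_neighborFinset v := by
    have : (hypercube n).neighborFinset v = Finset.univ.image fun i => flipAt i v := by
      ext w
      simp [hypercube_adj_iff, eq_comm]
    rw [this, Finset.card_image_of_injective _ (flipAt_injective v), Finset.card_univ,
      Fintype.card_fin]
  eq_of_common u v x y z huv hux hvx huy hvy huz hvz hxz hyz := by
    rw [SimpleGraph.adj_comm] at hvz hvx hvy
    simp only [hypercube_adj_iff] at *
    obtain ⟨c, rfl⟩ := huz
    obtain ⟨d, rfl⟩ := hvz
    obtain ⟨a, rfl⟩ := hux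
    obtain ⟨b, rfl⟩ := huy
    obtain ⟨e, he⟩ := hvx
    obtain ⟨f, hf⟩ := hvy
    have hac : a ≠ c := fun h => hxz (by rw [h])
    have hbc : b ≠ c := fun h => hyz (by rw [h])
    have hcd : c ≠ d := by
      rintro rfl
      exact huv (flipAt_flipAt _ _).symm
    have h1 : flipAt a u = flipAt e (flipAt d (flipAt c u)) := by rw [he, flipAt_flipAt]
    have h2 : flipAt b u = flipAt f (flipAt d (flipAt c u)) := by rw [hf, flipAt_flipAt]
    rw [(eq_or_eq_of_flipAt hcd h1).resolve_left hac, (eq_or_eq_of_flipAt hcd h2).resolve_left hbc]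
  exists_common u v w hvw huv huw := by
    simp only [hypercube_adj_iff] at *
    obtain ⟨a, rfl⟩ := huv
    obtain ⟨b, rfl⟩ := huw
    have hab : a ≠ b := fun h => hvw (by rw [h])
    refine ⟨flipAt b (flipAt a u), fun h => ?_, ⟨b, ?_⟩, ⟨a, ?_⟩⟩
    · have := congrFun h a
      simp [flipAt, hab] at this
    · rw [flipAt_flipAt]
    · rw [flipAt_comm a b, flipAt_flipAt]

theorem close_hypercube {n : ℕ} {u v : Fin n → Bool} (h : Close (hypercube n) u v) :
    ∃ a b, a ≠ b ∧ v = flipAt b (flipAt a u) := by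
  obtain ⟨huv, x, hux, hvx⟩ := h
  rw [SimpleGraph.adj_comm] at hvx
  rw [hypercube_adj_iff] at hux hvx
  obtain ⟨a, rfl⟩ := hux
  obtain ⟨b, rfl⟩ := hvx
  refine ⟨a, b, ?_, rfl⟩
  rintro rfl
  exact huv (flipAt_flipAt _ _).symm

theorem not_adj_of_adj_of_adj {n : ℕ} {u v w : Fin n → Bool} (huv : (hypercube n).Adj u v)
    (huw : (hypercube n).Adj u w) : ¬ (hypercube n).Adj v w := by
  intro hvw
  rw [hypercube_adj_iff] at *
  obtain ⟨a, rfl⟩ := huv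
  obtain ⟨b, rfl⟩ := huw
  obtain ⟨c, hc⟩ := hvw
  have h1 := congrFun hc a
  have h2 := congrFun hc b
  have h3 := congrFun hc c
  simp only [flipAt] at h1 h2 h3
  grind

theorem exists_common_of_close {n : ℕ} {u v w : Fin n → Bool} (huv : Close (hypercube n) u v)
    (huw : Close (hypercube n) u w) (hvw : Close (hypercube n) v w) :
    ∃ x, (hypercube n).Adj x u ∧ (hypercube n).Adj x v ∧ (hypercube n).Adj x w := by
  obtain ⟨a, b, hab, rfl⟩ := close_hypercube huv
  obtain ⟨c, d, hcd, rfl⟩ := close_hypercube huw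
  obtain ⟨e, f, hef, h⟩ := close_hypercube hvw
  have key : a = c ∨ a = d ∨ b = c ∨ b = d := by
    have h1 := congrFun h a
    have h2 := congrFun h b
    have h3 := congrFun h c
    have h4 := congrFun h d
    simp only [flipAt] at h1 h2 h3 h4
    grind
  have adj1 : ∀ i, (hypercube n).Adj (flipAt i u) u := fun i =>
    ((hypercube_adj_iff _ _).2 ⟨i, rfl⟩).symm
  have adj2 : ∀ i j, (hypercube n).Adj (flipAt i u) (flipAt j (flipAt i u)) := fun i j =>
    (hypercube_adj_iff _ _).2 ⟨j, rfl⟩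
  rcases key with rfl | rfl | rfl | rfl
  · exact ⟨_, adj1 a, adj2 _ _, adj2 _ _⟩
  · exact ⟨_, adj1 a, adj2 _ _, flipAt_comm a c u ▸ adj2 _ _⟩
  · exact ⟨_, adj1 b, flipAt_comm b a u ▸ adj2 _ _, adj2 _ _⟩
  · exact ⟨_, adj1 b, flipAt_comm b a u ▸ adj2 _ _, flipAt_comm b c u ▸ adj2 _ _⟩

/-- A vertex `u` outside the neighbourhood of `x` is close to at most three neighbours of `x`:
if there is one, then `u` and `x` are at distance three. -/
theorem card_close_le_three {n : ℕ} {u x : Fin n → Bool} (hux : ¬ (hypercube n).Adj x u)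
    {S : Finset (Fin n → Bool)} (hS : ∀ y ∈ S, (hypercube n).Adj x y ∧ Close (hypercube n) y u) :
    S.card ≤ 3 := by
  classical
  rcases S.eq_empty_or_nonempty with rfl | ⟨y, hy⟩
  · simp
  obtain ⟨hxy, hyu⟩ := hS y hy
  obtain ⟨b, c, hbc, rfl⟩ := close_hypercube hyu
  obtain ⟨a, rfl⟩ := (hypercube_adj_iff _ _).1 hxy
  have hab : a ≠ b := by
    rintro rfl
    refine hux ((hypercube_adj_iff _ _).2 ⟨c, ?_⟩)
    rw [flipAt_flipAt]
  have hac : a ≠ c := by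
    rintro rfl
    refine hux ((hypercube_adj_iff _ _).2 ⟨b, ?_⟩)
    rw [flipAt_comm a b, flipAt_flipAt]
  have hsub : S ⊆ {flipAt a x, flipAt b x, flipAt c x} := by
    intro z hz
    obtain ⟨hxz, hzu⟩ := hS z hz
    obtain ⟨e, f, hef, h⟩ := close_hypercube hzu
    obtain ⟨d, rfl⟩ := (hypercube_adj_iff _ _).1 hxz
    have hd : d = a ∨ d = b ∨ d = c := by
      have h1 := congrFun h a
      have h2 := congrFun h b
      have h3 := congrFun h c
      simp only [flipAt] at h1 h2 h3
      grind
    rcases hd with rfl | rfl | rfl <;> simp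
  exact (Finset.card_le_card hsub).trans Finset.card_le_three

/-! ### Repeated colours -/

noncomputable instance instDecidableRelClose {V : Type*} (G : SimpleGraph V) :
    DecidableRel (Close G) :=
  Classical.decRel _

/-- At least `r` vertices of `B` repeat the colour of a vertex of `A`. The vertices whose colours
are repeated lie outside the set `B'` of the repeating ones, so that for a random colouring the
`r` coincidences are independent. -/
def HasRepeats {V C : Type*} (χ : V → C) (A B : Finset V) (r : ℕ) : Prop :=
  ∃ B' ⊆ B, r ≤ B'.card ∧ ∃ s : V → V, ∀ b ∈ B', s b ∈ A ∧ s b ∉ B' ∧ χ (s b) = χ b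

/-- In the graphs `G` and `H` every vertex sees the same set of colours. -/
def SameNeighborColours {V C : Type*} (G H : SimpleGraph V) (χ : V → C) : Prop :=
  ∀ v, χ '' G.neighborSet v = χ '' H.neighborSet v

section

variable {V C : Type*} [DecidableEq V]

/-- If few vertices of `W` repeat a colour, then few vertices of `W` share their colour with
another vertex of `W`. -/
theorem exists_small_of_not_hasRepeats [Nonempty V] {χ : V → C} {W : Finset V} {r : ℕ}
    (h : ¬ HasRepeats χ W W r) :
    ∃ Z : Finset V, Z.card ≤ 2 * r ∧ ∀ x ∈ W, ∀ y ∈ W, χ x = χ y → x ≠ y → x ∈ Z := by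
  -- `s` sends a vertex to a fixed representative of its colour class in `W`.
  have hrep : ∀ c : C, ∃ x : V, ∀ y ∈ W, χ y = c → x ∈ W ∧ χ x = c := by
    intro c
    by_cases hc : ∃ x ∈ W, χ x = c
    · obtain ⟨x, hx⟩ := hc
      exact ⟨x, fun _ _ _ => hx⟩
    · exact ⟨Classical.arbitrary V, fun y hy hyc => (hc ⟨y, hy, hyc⟩).elim⟩
  choose rep hrepW using hrep
  let s : V → V := fun x => rep (χ x)
  have hsW : ∀ x ∈ W, s x ∈ W ∧ χ (s x) = χ x := fun x hx => hrepW _ x hx rfl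
  let B := W.filter fun x => s x ≠ x
  have hB : B.card < r := by
    by_contra hr
    refine h ⟨B, Finset.filter_subset _ _, not_lt.1 hr, s, fun b hb => ?_⟩
    have hb' := hsW b (Finset.mem_filter.1 hb).1
    refine ⟨hb'.1, fun hsb => ?_, hb'.2⟩
    apply (Finset.mem_filter.1 hsb).2
    simp only [s] at hb' ⊢
    rw [hb'.2]
  refine ⟨B ∪ B.image s, ?_, fun x hx y hy hxy hne => ?_⟩
  · have := Finset.card_union_le B (B.image s)
    have := Finset.card_image_le (s := B) (f := s)
    omega
  · have hs : s x = s y := by simp only [s, hxy]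
    by_cases hsx : s x = x
    · refine Finset.mem_union_right _ (Finset.mem_image.2 ⟨y, Finset.mem_filter.2 ⟨hy, ?_⟩, ?_⟩)
      · rw [← hs, hsx]
        exact hne
      · rw [← hs, hsx]
    · exact Finset.mem_union_left _ (Finset.mem_filter.2 ⟨hx, hsx⟩)

/-! ### Pairs with a common neighbour -/

variable [Fintype V] {G H : SimpleGraph V} [DecidableRel G.Adj] [DecidableRel H.Adj] {n : ℕ}

theorem IsZeroTwoGraph.card_inter_le_two (hG : IsZeroTwoGraph G n) {u v : V} (huv : u ≠ v) :
    (G.neighborFinset u ∩ G.neighborFinset v).card ≤ 2 := by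
  by_contra! h
  obtain ⟨a, b, c, ha, hb, hc, hab, hac, hbc⟩ := Finset.two_lt_card_iff.1 h
  simp only [Finset.mem_inter, SimpleGraph.mem_neighborFinset] at ha hb hc
  exact hab (hG.eq_of_common u v a b c huv ha.1 ha.2 hb.1 hb.2 hc.1 hc.2 hac hbc)

theorem card_inter_neighborFinset (U : Finset V) (x : V) :
    (U ∩ G.neighborFinset x).card = ∑ u ∈ U, if G.Adj u x then 1 else 0 := by
  rw [← Finset.card_filter]
  congr 1
  ext u
  simp [G.adj_comm]

theorem IsZeroTwoGraph.sum_sq_card_inter_le (hG : IsZeroTwoGraph G n) {U : Finset V}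
    (hU : U.card = n) :
    ∑ x, (U ∩ G.neighborFinset x).card ^ 2 ≤ 3 * n ^ 2 := by
  have h1 : ∀ x, (U ∩ G.neighborFinset x).card ^ 2 =
      ∑ u ∈ U, ∑ v ∈ U, (if G.Adj u x then 1 else 0) * (if G.Adj v x then 1 else 0) := by
    intro x
    rw [card_inter_neighborFinset, sq, Finset.sum_mul_sum]
  have h2 : ∀ u v, ∑ x, (if G.Adj u x then 1 else 0) * (if G.Adj v x then 1 else 0) =
      (G.neighborFinset u ∩ G.neighborFinset v).card := by
    intro u v
    rw [Finset.card_eq_sum_ones, ← Finset.sum_filter_of_ne (p := fun x => G.Adj u x ∧ G.Adj v x)]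
    · refine Finset.sum_congr ?_ fun x hx => ?_
      · ext x
        simp
      · simp only [Finset.mem_inter, SimpleGraph.mem_neighborFinset] at hx
        simp [hx.1, hx.2]
    · intro x _ hx
      by_contra hne
      apply hx
      by_cases h : G.Adj u x <;> by_cases h' : G.Adj v x <;> simp_all
  calc ∑ x, (U ∩ G.neighborFinset x).card ^ 2
      = ∑ u ∈ U, ∑ v ∈ U, (G.neighborFinset u ∩ G.neighborFinset v).card := by
        simp_rw [h1]
        rw [Finset.sum_comm]
        refine Finset.sum_congr rfl fun u _ => ?_
        rw [Finset.sum_comm]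
        exact Finset.sum_congr rfl fun v _ => h2 u v
    _ ≤ ∑ u ∈ U, ∑ v ∈ U, ((if u = v then n else 0) + 2) := by
        refine Finset.sum_le_sum fun u _ => Finset.sum_le_sum fun v _ => ?_
        split_ifs with h
        · subst h
          rw [Finset.inter_self, hG.card_neighborFinset]
          omega
        · simpa using hG.card_inter_le_two h
    _ = 3 * n ^ 2 := by
        simp only [Finset.sum_add_distrib, Finset.sum_ite_eq, Finset.sum_const, hU, smul_eq_mul]
        rw [Finset.sum_congr rfl (g := fun _ => n) fun u hu => by simp [hu]]
        rw [Finset.sum_const, hU, smul_eq_mul]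
        ring

theorem IsZeroTwoGraph.sq_sum_card_inter_le (hG : IsZeroTwoGraph G n) {U : Finset V}
    (hU : U.card = n) (Z : Finset V) :
    (∑ u ∈ U, (G.neighborFinset u ∩ Z).card) ^ 2 ≤ Z.card * (3 * n ^ 2) := by
  have h : ∑ u ∈ U, (G.neighborFinset u ∩ Z).card = ∑ x ∈ Z, (U ∩ G.neighborFinset x).card := by
    simp_rw [card_inter_neighborFinset]
    rw [Finset.sum_comm]
    refine Finset.sum_congr rfl fun u _ => ?_
    rw [Finset.inter_comm, card_inter_neighborFinset]
    simp_rw [G.adj_comm]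
  rw [h]
  refine (sq_sum_le_card_mul_sum_sq (s := Z)).trans (Nat.mul_le_mul_left _ ?_)
  exact (Finset.sum_le_univ_sum_of_nonneg fun _ => Nat.zero_le _).trans
    (hG.sum_sq_card_inter_le hU)

/-- Let `u` be an `H`-neighbour of `v`, and let `Z` contain all vertices whose colour occurs more
than once in the `G`-neighbourhood of the `H`-neighbourhood of `v`. A `G`-neighbour `x ∉ Z` of `u`
has the colour of some `H`-neighbour `w` of `u`. Unless `w = v`, the second common `H`-neighbour
`u'` of `v` and `w` sees this colour as well, and it can do so in `G` only at `x`. The vertices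
`u'` so obtained are distinct. -/
theorem card_sdiff_le_card_close {χ : V → C} (hH : IsZeroTwoGraph H n)
    (hχ : SameNeighborColours G H χ) {u v : V} (huv : H.Adj v u) {Z : Finset V}
    (hZ : ∀ x ∈ (H.neighborFinset v).biUnion fun w => G.neighborFinset w,
      ∀ y ∈ (H.neighborFinset v).biUnion fun w => G.neighborFinset w,
        χ x = χ y → x ≠ y → x ∈ Z) :
    (G.neighborFinset u \ Z).card ≤ ((H.neighborFinset v).filter fun u' => Close G u u').card + 1
    := by
  have hw : ∀ x ∈ G.neighborFinset u \ Z, ∃ w, H.Adj u w ∧ χ w = χ x := by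
    intro x hx
    have : χ x ∈ χ '' H.neighborSet u := by
      rw [← hχ u]
      exact ⟨x, by simpa using (Finset.mem_sdiff.1 hx).1, rfl⟩
    simpa using this
  have : Nonempty V := ⟨v⟩
  choose! w hw using hw
  have hinj : ∀ x ∈ G.neighborFinset u \ Z, ∀ y ∈ G.neighborFinset u \ Z, w x = w y → x = y := by
    intro x hx y hy hxy
    by_contra hne
    refine (Finset.mem_sdiff.1 hx).2 (hZ x ?_ y ?_ ?_ hne)
    · exact Finset.mem_biUnion.2 ⟨u, by simpa using huv, (Finset.mem_sdiff.1 hx).1⟩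
    · exact Finset.mem_biUnion.2 ⟨u, by simpa using huv, (Finset.mem_sdiff.1 hy).1⟩
    · rw [← (hw x hx).2, hxy, (hw y hy).2]
  let T := (G.neighborFinset u \ Z).filter fun x => w x ≠ v
  have hT : (G.neighborFinset u \ Z).card ≤ T.card + 1 := by
    rw [← Finset.card_filter_add_card_filter_not (s := G.neighborFinset u \ Z) (fun x => w x ≠ v)]
    refine Nat.add_le_add_left (Finset.card_le_one.2 fun x hx y hy => ?_) _
    simp only [Finset.mem_filter, not_not] at hx hy
    exact hinj x hx.1 y hy.1 (hx.2.trans hy.2.symm)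
  refine hT.trans (Nat.add_le_add_right ?_ 1)
  have hg : ∀ x ∈ T, ∃ u', u' ≠ u ∧ H.Adj u' v ∧ H.Adj u' (w x) := fun x hx =>
    hH.exists_common u v (w x) (Ne.symm (Finset.mem_filter.1 hx).2) huv.symm
      (hw x (Finset.mem_filter.1 hx).1).1
  choose! g hg using hg
  refine Finset.card_le_card_of_injOn g (fun x hx => ?_) (fun x hx y hy hxy => ?_)
  · have hx' := (Finset.mem_filter.1 hx).1
    have : χ (w x) ∈ χ '' G.neighborSet (g x) := by
      rw [hχ (g x)]
      exact ⟨w x, (hg x hx).2.2, rfl⟩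
    obtain ⟨x', hx1, hx2⟩ := this
    have hxx : x = x' := by
      by_contra hne
      refine (Finset.mem_sdiff.1 hx').2 (hZ x ?_ x' ?_ ?_ hne)
      · exact Finset.mem_biUnion.2 ⟨u, by simpa using huv, (Finset.mem_sdiff.1 hx').1⟩
      · exact Finset.mem_biUnion.2 ⟨g x, by simpa using (hg x hx).2.1.symm, by simpa using hx1⟩
      · rw [hx2, (hw x hx').2]
    subst hxx
    simp only [Finset.coe_filter, Set.mem_ofPred_eq, SimpleGraph.mem_neighborFinset]
    exact ⟨(hg x hx).2.1.symm, (hg x hx).1.symm, x, by simpa using (Finset.mem_sdiff.1 hx').1, hx1⟩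
  · have hx' := Finset.mem_filter.1 hx
    have hy' := Finset.mem_filter.1 hy
    refine hinj x hx'.1 y hy'.1 (hH.eq_of_common u (g x) (w x) (w y) v (hg x hx).1.symm
      (hw x hx'.1).1 (hg x hx).2.2 (hw y hy'.1).1 ?_ huv.symm (hg x hx).2.1 hx'.2 hy'.2)
    have hxy' : g x = g y := hxy
    rw [hxy']
    exact (hg y hy).2.2

end

/-! ### Comparing the two hypercube structures -/

section

variable {n : ℕ} {C : Type*} {H : SimpleGraph (Fin n → Bool)}
  [DecidableRel (hypercube n).Adj] [DecidableRel H.Adj]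

/-- Let `d y` be the number of neighbours of `y` in `U`. A triple in `U` has a pair that is not
close or a common neighbour, and the number of triples of the latter kind is at most
`∑ y, d y ^ 3`, which is at most `(max d) * ∑ y, d y ^ 2`. -/
theorem exists_pow_three_le (hG : IsZeroTwoGraph (hypercube n) n) {U : Finset (Fin n → Bool)}
    (hU : U.card = n) :
    ∃ x, n ^ 3 ≤ 3 * (n * ((U ×ˢ U).filter fun p => ¬ Close (hypercube n) p.1 p.2).card) +
      (U ∩ (hypercube n).neighborFinset x).card * (3 * n ^ 2) := by
  obtain ⟨x₀, -, hx₀⟩ := Finset.exists_max_image (Finset.univ : Finset (Fin n → Bool))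
    (fun x => (U ∩ (hypercube n).neighborFinset x).card) Finset.univ_nonempty
  refine ⟨x₀, ?_⟩
  let N := (U ×ˢ U).filter fun p => ¬ Close (hypercube n) p.1 p.2
  let T := fun x => U ∩ (hypercube n).neighborFinset x
  let A := (U ×ˢ N)
  let A2 := A.image fun p => (p.2.1, p.1, p.2.2)
  let A3 := A.image fun p => (p.2.1, p.2.2, p.1)
  let D := (Finset.univ : Finset (Fin n → Bool)).biUnion fun x => T x ×ˢ T x ×ˢ T x
  have hcover : U ×ˢ U ×ˢ U ⊆ ((A ∪ A2) ∪ A3) ∪ D := by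
    rintro ⟨u, v, w⟩ h
    simp only [Finset.mem_product] at h
    obtain ⟨hu, hv, hw⟩ := h
    by_cases huv : Close (hypercube n) u v
    · by_cases huw : Close (hypercube n) u w
      · by_cases hvw : Close (hypercube n) v w
        · obtain ⟨x, h1, h2, h3⟩ := exists_common_of_close huv huw hvw
          refine Finset.mem_union_right _ (Finset.mem_biUnion.2 ⟨x, Finset.mem_univ _, ?_⟩)
          simp [T, hu, hv, hw, h1, h2, h3]
        · refine Finset.mem_union_left _ (Finset.mem_union_left _ (Finset.mem_union_left _ ?_))
          simp [A, N, hu, hv, hw, hvw]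
      · refine Finset.mem_union_left _ (Finset.mem_union_left _ (Finset.mem_union_right _ ?_))
        refine Finset.mem_image.2 ⟨(v, u, w), ?_, rfl⟩
        simp [A, N, hu, hv, hw, huw]
    · refine Finset.mem_union_left _ (Finset.mem_union_right _ ?_)
      refine Finset.mem_image.2 ⟨(w, u, v), ?_, rfl⟩
      simp [A, N, hu, hv, hw, huv]
  have hA : A.card = n * N.card := by rw [Finset.card_product, hU]
  have hA2 : A2.card ≤ n * N.card := hA ▸ Finset.card_image_le
  have hA3 : A3.card ≤ n * N.card := hA ▸ Finset.card_image_le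
  have hD : D.card ≤ (T x₀).card * (3 * n ^ 2) := by
    calc D.card ≤ ∑ x, (T x ×ˢ T x ×ˢ T x).card := Finset.card_biUnion_le
      _ ≤ ∑ x, (T x₀).card * (T x).card ^ 2 := by
          refine Finset.sum_le_sum fun x _ => ?_
          rw [Finset.card_product, Finset.card_product, sq]
          exact Nat.mul_le_mul_right _ (hx₀ x (Finset.mem_univ _))
      _ = (T x₀).card * ∑ x, (T x).card ^ 2 := by rw [Finset.mul_sum]
      _ ≤ _ := Nat.mul_le_mul_left _ (hG.sum_sq_card_inter_le hU)
  have h1 := Finset.card_le_card hcover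
  have h2 := Finset.card_union_le ((A ∪ A2) ∪ A3) D
  have h3 := Finset.card_union_le (A ∪ A2) A3
  have h4 := Finset.card_union_le A A2
  rw [Finset.card_product, Finset.card_product, hU] at h1
  have h5 : n ^ 3 = n * (n * n) := by ring
  rw [h5]
  change _ ≤ 3 * (n * N.card) + (T x₀).card * (3 * n ^ 2)
  omega

/-- A vertex of `U` outside the neighbourhood of `x` is close to at most three vertices inside. -/
theorem mul_card_inter_le {U : Finset (Fin n → Bool)} (hU : U.card = n) (x : Fin n → Bool) :
    (n - (U ∩ (hypercube n).neighborFinset x).card) *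
        ((U ∩ (hypercube n).neighborFinset x).card - 3) ≤
      ((U ×ˢ U).filter fun p => ¬ Close (hypercube n) p.1 p.2).card := by
  set T := U ∩ (hypercube n).neighborFinset x with hT
  have h1 : n - T.card = (U \ T).card := by
    rw [Finset.card_sdiff_of_subset Finset.inter_subset_left, hU]
  have h2 : ∀ u ∈ U \ T, T.card - 3 ≤ (T.filter fun y => ¬ Close (hypercube n) y u).card := by
    intro u hu
    have hux : ¬ (hypercube n).Adj x u := by
      intro h
      simp only [hT, Finset.mem_sdiff, Finset.mem_inter, SimpleGraph.mem_neighborFinset] at hu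
      exact hu.2 ⟨hu.1, h⟩
    have := card_close_le_three hux (S := T.filter fun y => Close (hypercube n) y u) fun y hy => by
      simp only [hT, Finset.mem_filter, Finset.mem_inter, SimpleGraph.mem_neighborFinset] at hy
      exact ⟨hy.1.2, hy.2⟩
    have h3 := Finset.card_filter_add_card_filter_not (s := T)
      (fun y => Close (hypercube n) y u)
    omega
  rw [h1]
  calc (U \ T).card * (T.card - 3)
      ≤ ∑ u ∈ U \ T, (T.filter fun y => ¬ Close (hypercube n) y u).card := by
        rw [← smul_eq_mul, ← Finset.sum_const]
        exact Finset.sum_le_sum h2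
    _ = ((U \ T).sigma fun u => T.filter fun y => ¬ Close (hypercube n) y u).card :=
        (Finset.card_sigma _ _).symm
    _ ≤ _ := by
        refine Finset.card_le_card_of_injOn (fun p => (p.2, p.1)) (fun p hp => ?_) ?_
        · simp only [Finset.coe_sigma, Set.mem_sigma_iff, Finset.mem_coe, Finset.mem_sdiff,
            Finset.mem_filter] at hp
          simp only [Finset.coe_filter, Set.mem_ofPred_eq, Finset.mem_product]
          exact ⟨⟨Finset.inter_subset_left hp.2.1, hp.1.1⟩, hp.2.2⟩
        · rintro ⟨a, b⟩ _ ⟨c, d⟩ _ h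
          simp only [Prod.mk.injEq] at h
          obtain ⟨rfl, rfl⟩ := h
          rfl

/-- If few colours are repeated in the `G`-neighbourhood of the `H`-neighbourhood of `v`, then
this `H`-neighbourhood mostly agrees with the `G`-neighbourhood of some vertex. The constant
`21600 = 6 * 60 ^ 2` makes all but a `1 / 60` fraction of the pairs `(u, x)`, with `u` in the
`H`-neighbourhood of `v` and `x` a `G`-neighbour of `u`, avoid repeated colours. -/
theorem exists_large_inter {χ : (Fin n → Bool) → C} (hG : IsZeroTwoGraph (hypercube n) n)
    (hH : IsZeroTwoGraph H n) (hχ : SameNeighborColours (hypercube n) H χ) (hn : 60 ≤ n)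
    (v : Fin n → Bool)
    (hrep : ¬ HasRepeats χ
      ((H.neighborFinset v).biUnion fun w => (hypercube n).neighborFinset w)
      ((H.neighborFinset v).biUnion fun w => (hypercube n).neighborFinset w) (n ^ 2 / 21600)) :
    ∃ x, 5 * n ≤ 6 * (H.neighborFinset v ∩ (hypercube n).neighborFinset x).card := by
  obtain ⟨Z, hZc, hZ⟩ := exists_small_of_not_hasRepeats hrep
  set U := H.neighborFinset v with hUdef
  have hU : U.card = n := hH.card_neighborFinset v
  set D := ∑ u ∈ U, ((hypercube n).neighborFinset u ∩ Z).card with hD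
  have hD2 : D ^ 2 ≤ Z.card * (3 * n ^ 2) := hG.sq_sum_card_inter_le hU Z
  have hD60 : 60 * D ≤ n ^ 2 := by
    have h1 : 21600 * (n ^ 2 / 21600) ≤ n ^ 2 := Nat.mul_div_le _ _
    have h2 : (60 * D) ^ 2 ≤ (n ^ 2) ^ 2 := by
      calc (60 * D) ^ 2 = 3600 * D ^ 2 := by ring
        _ ≤ 3600 * (2 * (n ^ 2 / 21600) * (3 * n ^ 2)) :=
          Nat.mul_le_mul_left _ (hD2.trans (Nat.mul_le_mul_right _ hZc))
        _ = 21600 * (n ^ 2 / 21600) * n ^ 2 := by ring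
        _ ≤ n ^ 2 * n ^ 2 := Nat.mul_le_mul_right _ h1
        _ = (n ^ 2) ^ 2 := by ring
    exact (Nat.pow_le_pow_iff_left two_ne_zero).1 h2
  set N := ((U ×ˢ U).filter fun p => ¬ Close (hypercube n) p.1 p.2).card with hN
  have hND : N ≤ D + n := by
    have h1 : N = ∑ u ∈ U, (U.filter fun u' => ¬ Close (hypercube n) u u').card := by
      rw [hN, Finset.card_filter, Finset.sum_product]
      simp_rw [Finset.card_filter]
    have h2 : ∀ u ∈ U, (U.filter fun u' => ¬ Close (hypercube n) u u').card ≤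
        ((hypercube n).neighborFinset u ∩ Z).card + 1 := by
      intro u hu
      have h3 := card_sdiff_le_card_close hH hχ (by simpa [hUdef] using hu) hZ
      rw [← hUdef] at h3
      have h4 := Finset.card_filter_add_card_filter_not (s := U)
        (fun u' => Close (hypercube n) u u')
      have h5 := Finset.card_sdiff_add_card_inter ((hypercube n).neighborFinset u) Z
      rw [hG.card_neighborFinset] at h5
      omega
    calc N ≤ ∑ u ∈ U, (((hypercube n).neighborFinset u ∩ Z).card + 1) := by
          rw [h1]
          exact Finset.sum_le_sum h2
      _ = D + n := by rw [Finset.sum_add_distrib, Finset.sum_const, hU, smul_eq_mul, mul_one]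
  have hN30 : 30 * N ≤ n ^ 2 := by nlinarith
  obtain ⟨x, hx⟩ := exists_pow_three_le hG hU
  have hx2 := mul_card_inter_le hU x
  refine ⟨x, ?_⟩
  set d := (U ∩ (hypercube n).neighborFinset x).card with hd
  have hdn : d ≤ n := hU ▸ Finset.card_le_card Finset.inter_subset_left
  rw [← hN] at hx hx2
  -- Some `x` has at least `3 n / 10` neighbours in `U`; then the pairs between these and the rest
  -- of `U`, of which almost none are close, leave room for at most `n / 6` others.
  have hd3 : 3 * n ≤ 10 * d := by
    have h1 : n ^ 2 * (3 * n) ≤ n ^ 2 * (10 * d) := by nlinarith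
    exact Nat.le_of_mul_le_mul_left h1 (by positivity)
  obtain ⟨e, he⟩ : ∃ e, d = e + 3 := ⟨d - 3, by omega⟩
  obtain ⟨k, hk⟩ : ∃ k, n = d + k := ⟨n - d, by omega⟩
  rw [he, Nat.add_sub_cancel, ← he] at hx2
  have hk' : n - d = k := by omega
  rw [hk'] at hx2
  have he5 : n ≤ 5 * e := by omega
  have h1 : n * (6 * k) ≤ n * n := by nlinarith
  have := Nat.le_of_mul_le_mul_left h1 (by omega)
  omega

/-- If colours are not repeated too often, then every edge of `H` is an edge of the hypercube. For
an `H`-edge `v u` outside the hypercube, most `H`-neighbours `w` of `u` are also hypercube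
neighbours of `u`, and most of these are `H`-adjacent to a hypercube neighbour `y` of `v`; then `y`
sees the colour of `w` in the hypercube as well, at a vertex other than `w`, and `n / 2` colours
around `u` are repeated within distance two of `v`. -/
theorem adj_of_not_hasRepeats {χ : (Fin n → Bool) → C} (hG : IsZeroTwoGraph (hypercube n) n)
    (hH : IsZeroTwoGraph H n) (hχ : SameNeighborColours (hypercube n) H χ) (hn : 60 ≤ n)
    (hrep : ∀ U : Finset (Fin n → Bool), U.card = n → ¬ HasRepeats χ
      (U.biUnion fun w => (hypercube n).neighborFinset w)
      (U.biUnion fun w => (hypercube n).neighborFinset w) (n ^ 2 / 21600))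
    (hrep' : ∀ t u, ¬ HasRepeats χ
      (((hypercube n).neighborFinset t).biUnion fun w => (hypercube n).neighborFinset w)
      ((hypercube n).neighborFinset u) (n / 2)) {v u : Fin n → Bool} (huv : H.Adj v u) :
    (hypercube n).Adj v u := by
  have hcol : ∀ a b, H.Adj a b → ∃ x, (hypercube n).Adj a x ∧ χ x = χ b := by
    intro a b hab
    have : χ b ∈ χ '' (hypercube n).neighborSet a := by
      rw [hχ a]
      exact ⟨b, hab, rfl⟩
    simpa using this
  -- The `H`-neighbourhood of `a` mostly agrees with its own `G`-neighbourhood.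
  have hlarge : ∀ a, 5 * n ≤ 6 * (H.neighborFinset a ∩ (hypercube n).neighborFinset a).card := by
    intro a
    obtain ⟨x, hx⟩ := exists_large_inter hG hH hχ hn a (hrep _ (hH.card_neighborFinset a))
    -- If `x ≠ a`, the colours of most neighbours of `x` are repeated around `a`.
    by_cases hxa : x = a
    · rwa [hxa] at hx
    exfalso
    obtain ⟨t, ht⟩ : ((hypercube n).neighborFinset a).Nonempty := by
      rw [← Finset.card_pos, hG.card_neighborFinset]
      omega
    let B := (H.neighborFinset a ∩ (hypercube n).neighborFinset x) \
      (hypercube n).neighborFinset a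
    have hBH : ∀ b ∈ B, H.Adj a b := fun b hb => by
      simpa using Finset.mem_of_mem_inter_left (Finset.mem_sdiff.1 hb).1
    choose! s hs using fun b hb => hcol a b (hBH b hb)
    refine hrep' t x ⟨B, Finset.sdiff_subset.trans Finset.inter_subset_right, ?_, s,
      fun b hb => ⟨?_, fun h => ?_, (hs b hb).2⟩⟩
    · have h1 := Finset.card_sdiff_add_card_inter
        (H.neighborFinset a ∩ (hypercube n).neighborFinset x) ((hypercube n).neighborFinset a)
      have h2 : ((H.neighborFinset a ∩ (hypercube n).neighborFinset x) ∩
          (hypercube n).neighborFinset a).card ≤ 2 :=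
        (Finset.card_le_card (Finset.inter_subset_inter_right Finset.inter_subset_right)).trans
          (hG.card_inter_le_two hxa)
      change _ ≤ B.card
      change B.card + _ = _ at h1
      omega
    · refine Finset.mem_biUnion.2 ⟨a, ?_, by simpa using (hs b hb).1⟩
      simpa [SimpleGraph.adj_comm] using ht
    · exact (Finset.mem_sdiff.1 h).2 (by simpa using (hs b hb).1)
  by_contra hnot
  -- The index `y` runs over the common neighbours of `v` in both graphs, and `w y` is the second
  -- common `H`-neighbour of `u` and `y`.
  let T := H.neighborFinset v ∩ (hypercube n).neighborFinset v
  have huT : u ∉ T := fun h => hnot (by simpa using Finset.mem_of_mem_inter_right h)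
  have hTH : ∀ y ∈ T, H.Adj v y := fun y hy => by simpa using Finset.mem_of_mem_inter_left hy
  have hTG : ∀ y ∈ T, (hypercube n).Adj v y := fun y hy => by
    simpa using Finset.mem_of_mem_inter_right hy
  choose! w hw using fun y (hy : y ∈ T) => hH.exists_common v u y
    (fun h => huT (h ▸ hy)) huv (hTH y hy)
  have hinj : Set.InjOn w T := by
    intro y hy z hz hyz
    have hyz' : w y = w z := hyz
    exact hH.eq_of_common v (w y) y z u (hw y hy).1.symm (hTH y hy) (hw y hy).2.2 (hTH z hz)
      (hyz' ▸ (hw z hz).2.2) huv (hw y hy).2.1 (fun h => huT (h ▸ hy)) (fun h => huT (h ▸ hz))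
  let T' := T.filter fun y => ¬ Close (hypercube n) y u
  let R := T'.filter fun y => w y ∈ (hypercube n).neighborFinset u
  have hT' : T.card ≤ T'.card + 3 := by
    have h1 := Finset.card_filter_add_card_filter_not (s := T)
      (fun y => Close (hypercube n) y u)
    have h2 := card_close_le_three hnot (S := T.filter fun y => Close (hypercube n) y u)
      fun y hy => ⟨hTG y (Finset.mem_filter.1 hy).1, (Finset.mem_filter.1 hy).2⟩
    change _ + T'.card = _ at h1
    omega
  have hR : 6 * T'.card ≤ 6 * R.card + n := by
    have h1 := Finset.card_filter_add_card_filter_not (s := T')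
      (fun y => w y ∈ (hypercube n).neighborFinset u)
    change R.card + _ = _ at h1
    have h2 : (T'.filter fun y => ¬ w y ∈ (hypercube n).neighborFinset u).card ≤
        (H.neighborFinset u \ (hypercube n).neighborFinset u).card := by
      refine Finset.card_le_card_of_injOn w (fun y hy => ?_) (hinj.mono fun y hy => ?_)
      · have hy' := Finset.mem_filter.1 hy
        refine Finset.mem_coe.2 (Finset.mem_sdiff.2 ⟨?_, hy'.2⟩)
        simpa using (hw y (Finset.mem_filter.1 hy'.1).1).2.1.symm
      · exact (Finset.mem_filter.1 (Finset.mem_filter.1 hy).1).1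
    have h3 := Finset.card_sdiff_add_card_inter (H.neighborFinset u)
      ((hypercube n).neighborFinset u)
    rw [hH.card_neighborFinset] at h3
    have h4 := hlarge u
    omega
  have hRT : ∀ y ∈ R, y ∈ T := fun y hy => (Finset.mem_filter.1 (Finset.mem_filter.1 hy).1).1
  have hs : ∀ b ∈ R.image w, ∃ c, c ∈ ((hypercube n).neighborFinset v).biUnion
      (fun w => (hypercube n).neighborFinset w) ∧ c ∉ R.image w ∧ χ c = χ b := by
    intro b hb
    obtain ⟨y, hy, rfl⟩ := Finset.mem_image.1 hb
    obtain ⟨c, hc1, hc2⟩ := hcol y (w y) (hw y (hRT y hy)).2.2.symm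
    refine ⟨c, Finset.mem_biUnion.2 ⟨y, by simpa using hTG y (hRT y hy), by simpa using hc1⟩,
      fun hcR => ?_, hc2⟩
    -- Otherwise `c` would be a common neighbour of `y` and `u`.
    obtain ⟨z, hz, rfl⟩ := Finset.mem_image.1 hcR
    refine (Finset.mem_filter.1 (Finset.mem_filter.1 hy).1).2
      ⟨fun h => huT (h ▸ hRT y hy), w z, hc1, ?_⟩
    simpa using (Finset.mem_filter.1 hz).2
  choose! s hs using hs
  refine hrep' v u ⟨R.image w, fun b hb => ?_, ?_, s, hs⟩
  · obtain ⟨y, hy, rfl⟩ := Finset.mem_image.1 hb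
    exact (Finset.mem_filter.1 hy).2
  · rw [Finset.card_image_of_injOn (hinj.mono fun y hy => hRT y hy)]
    have := hlarge v
    change _ ≤ 6 * T.card at this
    omega

end

/-! ### Repeated colours are unlikely -/

section

variable {V : Type*} [Fintype V] [DecidableEq V]

/-- If `s` maps `B` into its complement, then a colouring with `χ (s b) = χ b` on `B` is determined
by its values off `B`. -/
theorem card_colourings_repeating_le (q : ℕ) (B : Finset V) (s : B → V) :
    Nat.card {χ : V → Fin q // ∀ b : B, s b ∉ B ∧ χ (s b) = χ b} * q ^ B.card ≤
      q ^ Fintype.card V := by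
  have h : Nat.card {χ : V → Fin q // ∀ b : B, s b ∉ B ∧ χ (s b) = χ b} ≤
      Nat.card ({x : V // x ∉ B} → Fin q) := by
    refine Nat.card_le_card_of_injective (fun χ x => χ.1 x) fun χ ψ h => ?_
    have hout : ∀ x, x ∉ B → χ.1 x = ψ.1 x := fun x hx => congrFun h ⟨x, hx⟩
    ext1
    funext x
    by_cases hx : x ∈ B
    · rw [← (χ.2 ⟨x, hx⟩).2, ← (ψ.2 ⟨x, hx⟩).2]
      exact hout _ (χ.2 ⟨x, hx⟩).1
    · exact hout x hx
  have hcard : Nat.card ({x : V // x ∉ B} → Fin q) = q ^ (Fintype.card V - B.card) := by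
    rw [Nat.card_eq_fintype_card, Fintype.card_fun, Fintype.card_fin, Fintype.card_subtype_compl,
      Fintype.card_coe]
  rw [hcard] at h
  calc _ ≤ q ^ (Fintype.card V - B.card) * q ^ B.card := Nat.mul_le_mul_right _ h
    _ = q ^ Fintype.card V := by
      rw [← pow_add, Nat.sub_add_cancel (Finset.card_le_univ B)]

/-- First-moment bound: choose the repeating set among the subsets of `B`, then the vertices of `A`
whose colours are repeated. -/
theorem card_hasRepeats_le (q : ℕ) (A B : Finset V) (r : ℕ) :
    Nat.card {χ : V → Fin q // HasRepeats χ A B r} * q ^ r ≤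
      2 ^ B.card * A.card ^ r * q ^ Fintype.card V := by
  classical
  let F : (B' : Finset V) → (B' → V) → Finset (V → Fin q) := fun B' s =>
    Finset.univ.filter fun χ => ∀ b : B', s b ∉ B' ∧ χ (s b) = χ b
  have hF : ∀ B' ∈ B.powersetCard r, ∀ s, (F B' s).card * q ^ r ≤ q ^ Fintype.card V := by
    intro B' hB' s
    have h := card_colourings_repeating_le q B' s
    rw [(Finset.mem_powersetCard.1 hB').2] at h
    rwa [Nat.card_eq_fintype_card, Fintype.card_subtype] at h
  have hcover : (Finset.univ.filter fun χ : V → Fin q => HasRepeats χ A B r) ⊆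
      (B.powersetCard r).biUnion fun B' =>
        (Fintype.piFinset fun _ : B' => A).biUnion fun s => F B' s := by
    intro χ hχ
    obtain ⟨B₀, hB₀, hr, s, hs⟩ := (Finset.mem_filter.1 hχ).2
    obtain ⟨B', hB', hcard⟩ := Finset.exists_subset_card_eq hr
    refine Finset.mem_biUnion.2 ⟨B', Finset.mem_powersetCard.2 ⟨hB'.trans hB₀, hcard⟩, ?_⟩
    refine Finset.mem_biUnion.2 ⟨fun b => s b, ?_, ?_⟩
    · exact Fintype.mem_piFinset.2 fun b => (hs b (hB' b.2)).1
    · refine Finset.mem_filter.2 ⟨Finset.mem_univ _, fun b => ?_⟩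
      have := hs b (hB' b.2)
      exact ⟨fun h => this.2.1 (hB' h), this.2.2⟩
  rw [Nat.card_eq_fintype_card, Fintype.card_subtype]
  calc (Finset.univ.filter fun χ : V → Fin q => HasRepeats χ A B r).card * q ^ r
      ≤ (∑ B' ∈ B.powersetCard r, ∑ s ∈ Fintype.piFinset fun _ : B' => A, (F B' s).card)
          * q ^ r := by
        refine Nat.mul_le_mul_right _ ((Finset.card_le_card hcover).trans
          (Finset.card_biUnion_le.trans (Finset.sum_le_sum fun B' _ => Finset.card_biUnion_le)))
    _ = ∑ B' ∈ B.powersetCard r, ∑ s ∈ Fintype.piFinset fun _ : B' => A,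
          (F B' s).card * q ^ r := by
        simp_rw [Finset.sum_mul]
    _ ≤ ∑ B' ∈ B.powersetCard r, A.card ^ r * q ^ Fintype.card V := by
        refine Finset.sum_le_sum fun B' hB' => ?_
        refine (Finset.sum_le_sum fun s _ => hF B' hB' s).trans (le_of_eq ?_)
        rw [Finset.sum_const, Fintype.card_piFinset, Finset.prod_const, Finset.card_univ,
          Fintype.card_coe, (Finset.mem_powersetCard.1 hB').2, smul_eq_mul]
    _ ≤ 2 ^ B.card * A.card ^ r * q ^ Fintype.card V := by
        rw [Finset.sum_const, smul_eq_mul, mul_assoc, Finset.card_powersetCard]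
        exact Nat.mul_le_mul_right _ (Nat.choose_le_two_pow _ _)

end

theorem isProbabilityMeasure_uniformOn_fin {q : ℕ} (hq : 0 < q) :
    IsProbabilityMeasure (uniformOn (Set.univ : Set (Fin q))) := by
  have : NeZero q := ⟨hq.ne'⟩
  exact isProbabilityMeasure_uniformOn Set.finite_univ Set.univ_nonempty

theorem isProbabilityMeasure_randomColouring (n : ℕ) {q : ℕ} (hq : 0 < q) :
    IsProbabilityMeasure (randomColouring n q) := by
  have := isProbabilityMeasure_uniformOn_fin hq
  unfold randomColouring
  infer_instance

theorem randomColouring_apply (n : ℕ) {q : ℕ} (hq : 0 < q)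
    (P : ((Fin n → Bool) → Fin q) → Prop) :
    randomColouring n q {χ | P χ} = (Nat.card {χ // P χ} : ENNReal) / (q : ENNReal) ^ 2 ^ n := by
  classical
  have := isProbabilityMeasure_uniformOn_fin hq
  have h1 : ∀ χ, randomColouring n q {χ} = ((q : ENNReal) ^ 2 ^ n)⁻¹ := by
    intro χ
    unfold randomColouring
    rw [Measure.pi_singleton]
    simp [uniformOn_univ, ENNReal.inv_pow]
  have h2 : {χ | P χ} = ((Finset.univ.filter P : Finset _) : Set ((Fin n → Bool) → Fin q)) := by
    ext
    simp
  rw [h2, ← sum_measure_singleton]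
  simp_rw [h1]
  rw [Finset.sum_const, Nat.card_eq_fintype_card, Fintype.card_subtype, nsmul_eq_mul,
    div_eq_mul_inv]

theorem randomColouring_hasRepeats_le {n q M : ℕ} (hq : 0 < q) (hM : 0 < M)
    {A B : Finset (Fin n → Bool)} (r : ℕ) {b : ℕ} (hB : B.card ≤ b) (hA : M * A.card ≤ q) :
    randomColouring n q {χ | HasRepeats χ A B r} ≤ 2 ^ b / (M : ENNReal) ^ r := by
  rw [randomColouring_apply n hq]
  set c := Nat.card {χ : (Fin n → Bool) → Fin q // HasRepeats χ A B r} with hc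
  have h1 : c * q ^ r ≤ 2 ^ B.card * A.card ^ r * q ^ 2 ^ n := by
    have := card_hasRepeats_le q A B r
    rwa [Fintype.card_fun, Fintype.card_bool, Fintype.card_fin] at this
  have h2 : c * M ^ r ≤ 2 ^ b * q ^ 2 ^ n := by
    refine Nat.le_of_mul_le_mul_left ?_ (pow_pos hq r)
    calc q ^ r * (c * M ^ r) = c * q ^ r * M ^ r := by ring
      _ ≤ 2 ^ B.card * A.card ^ r * q ^ 2 ^ n * M ^ r := Nat.mul_le_mul_right _ h1
      _ = 2 ^ B.card * (M * A.card) ^ r * q ^ 2 ^ n := by rw [mul_pow]; ring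
      _ ≤ 2 ^ b * q ^ r * q ^ 2 ^ n := by gcongr; norm_num
      _ = q ^ r * (2 ^ b * q ^ 2 ^ n) := by ring
  have h3 : (c : ENNReal) * (M : ENNReal) ^ r ≤ 2 ^ b * (q : ENNReal) ^ 2 ^ n := by
    exact_mod_cast h2
  have hM0 : (M : ENNReal) ^ r ≠ 0 := pow_ne_zero _ (by exact_mod_cast hM.ne')
  have hMt : (M : ENNReal) ^ r ≠ ⊤ := ENNReal.pow_ne_top (ENNReal.natCast_ne_top M)
  refine ENNReal.div_le_of_le_mul ?_
  rw [ENNReal.mul_comm_div, ← mul_div_assoc, ENNReal.le_div_iff_mul_le (Or.inl hM0) (Or.inl hMt)]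
  exact h3

/-- Union bound over all sets of `n` vertices, at most `2 ^ (n ^ 2)` in number, and over all pairs
of vertices. -/
theorem randomColouring_exists_hasRepeats_le {n q M : ℕ} [DecidableRel (hypercube n).Adj]
    (hq : 0 < q) (hM : 0 < M) (hqM : M * n ^ 2 ≤ q) (r r' : ℕ) :
    randomColouring n q {χ | (∃ U : Finset (Fin n → Bool), U.card = n ∧ HasRepeats χ
      (U.biUnion fun w => (hypercube n).neighborFinset w)
      (U.biUnion fun w => (hypercube n).neighborFinset w) r) ∨ ∃ t u, HasRepeats χ
      (((hypercube n).neighborFinset t).biUnion fun w => (hypercube n).neighborFinset w)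
      ((hypercube n).neighborFinset u) r'} ≤
      4 ^ n ^ 2 / (M : ENNReal) ^ r + 8 ^ n / (M : ENNReal) ^ r' := by
  have hG := hypercube_isZeroTwoGraph n
  have hcard : ∀ U : Finset (Fin n → Bool), U.card = n →
      (U.biUnion fun w => (hypercube n).neighborFinset w).card ≤ n ^ 2 := by
    intro U hU
    refine Finset.card_biUnion_le.trans (le_of_eq ?_)
    rw [Finset.sum_congr rfl fun w _ => hG.card_neighborFinset w, Finset.sum_const, hU,
      smul_eq_mul, sq]
  have hcardM : ∀ U : Finset (Fin n → Bool), U.card = n →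
      M * (U.biUnion fun w => (hypercube n).neighborFinset w).card ≤ q := fun U hU =>
    (Nat.mul_le_mul_left _ (hcard U hU)).trans hqM
  have hV : Fintype.card (Fin n → Bool) = 2 ^ n := by simp
  refine (measure_mono (t := (⋃ U ∈ (Finset.univ : Finset (Fin n → Bool)).powersetCard n,
      {χ | HasRepeats χ (U.biUnion fun w => (hypercube n).neighborFinset w)
        (U.biUnion fun w => (hypercube n).neighborFinset w) r}) ∪
      ⋃ p ∈ (Finset.univ : Finset ((Fin n → Bool) × (Fin n → Bool))), {χ | HasRepeats χ
        (((hypercube n).neighborFinset p.1).biUnion fun w => (hypercube n).neighborFinset w)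
        ((hypercube n).neighborFinset p.2) r'}) ?_).trans ((measure_union_le _ _).trans
          (add_le_add ?_ ?_))
  · rintro χ (⟨U, hU, h⟩ | ⟨t, u, h⟩)
    · left
      simp only [Set.mem_iUnion]
      exact ⟨U, Finset.mem_powersetCard.2 ⟨Finset.subset_univ _, hU⟩, h⟩
    · right
      simp only [Set.mem_iUnion]
      exact ⟨(t, u), Finset.mem_univ _, h⟩
  · refine (measure_biUnion_finset_le _ _).trans ((Finset.sum_le_sum fun U hU =>
      randomColouring_hasRepeats_le hq hM r (hcard U (Finset.mem_powersetCard.1 hU).2)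
        (hcardM U (Finset.mem_powersetCard.1 hU).2)).trans ?_)
    rw [Finset.sum_const, Finset.card_powersetCard, Finset.card_univ, hV, nsmul_eq_mul,
      ← mul_div_assoc]
    refine ENNReal.div_le_div_right ?_ _
    have h1 : (2 ^ n).choose n * 2 ^ n ^ 2 ≤ 4 ^ n ^ 2 := by
      calc (2 ^ n).choose n * 2 ^ n ^ 2 ≤ (2 ^ n) ^ n * 2 ^ n ^ 2 :=
            Nat.mul_le_mul_right _ (Nat.choose_le_pow _ _)
        _ = (2 * 2) ^ n ^ 2 := by rw [← pow_mul, ← sq, mul_pow]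
    exact_mod_cast h1
  · refine (measure_biUnion_finset_le _ _).trans ((Finset.sum_le_sum fun p _ =>
      randomColouring_hasRepeats_le hq hM r' (hG.card_neighborFinset p.2).le
        (hcardM _ (hG.card_neighborFinset p.1))).trans ?_)
    rw [Finset.sum_const, Finset.card_univ, Fintype.card_prod, hV, nsmul_eq_mul, ← mul_div_assoc]
    refine ENNReal.div_le_div_right (le_of_eq ?_) _
    have h1 : 2 ^ n * 2 ^ n * 2 ^ n = 8 ^ n := by
      rw [← mul_pow, ← mul_pow]
      norm_num
    exact_mod_cast h1

/-! ### From coloured balls to neighbour colours -/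

theorem mem_ballVertices_one_iff {V : Type*} {G : SimpleGraph V} {v w : V} :
    w ∈ ballVertices G 1 v ↔ G.Adj v w ∨ v = w := by
  simp [ballVertices, SimpleGraph.edist_le_one_iff_adj_or_eq]

/-- An isomorphism of `1`-balls of the hypercube maps centre to centre, the centre being the only
vertex of its ball that is adjacent to all others. -/
theorem ballGraph_iso_centre {n : ℕ} (hn : 2 ≤ n) {v w : Fin n → Bool}
    (φ : ballGraph (hypercube n) 1 v ≃g ballGraph (hypercube n) 1 w) :
    (φ ⟨v, mem_ballVertices_one_iff.2 (Or.inr rfl)⟩ : Fin n → Bool) = w := by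
  classical
  set c : ballVertices (hypercube n) 1 v := ⟨v, mem_ballVertices_one_iff.2 (Or.inr rfl)⟩ with hc
  have hadj : ∀ y : ballVertices (hypercube n) 1 w, y ≠ φ c → (hypercube n).Adj (φ c) y := by
    intro y hy
    have h1 : φ.symm y ≠ c := fun h => hy (by rw [← h, RelIso.apply_symm_apply])
    have h2 : (ballGraph (hypercube n) 1 v).Adj c (φ.symm y) := by
      refine (mem_ballVertices_one_iff.1 (φ.symm y).2).resolve_right fun h => h1 ?_
      exact Subtype.ext h.symm
    have h3 := φ.map_rel_iff.2 h2
    rw [RelIso.apply_symm_apply] at h3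
    exact h3
  by_contra hne
  have hw : (hypercube n).Adj w (φ c) :=
    (mem_ballVertices_one_iff.1 (φ c).2).resolve_right (Ne.symm hne)
  obtain ⟨y, hy, hyc⟩ := Finset.exists_mem_ne (s := (hypercube n).neighborFinset w)
    (by rw [(hypercube_isZeroTwoGraph n).card_neighborFinset]; omega) (φ c : Fin n → Bool)
  rw [SimpleGraph.mem_neighborFinset] at hy
  refine not_adj_of_adj_of_adj hw hy (hadj ⟨y, mem_ballVertices_one_iff.2 (Or.inl hy)⟩ fun h => ?_)
  exact hyc (congrArg Subtype.val h)

theorem sameNeighborColours_comap {n : ℕ} (hn : 2 ≤ n) {C : Type*} {χ ψ : (Fin n → Bool) → C}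
    {f : (Fin n → Bool) ≃ (Fin n → Bool)}
    (hf : ∀ v, ColouringEquiv (ballGraph (hypercube n) 1 v) (ballGraph (hypercube n) 1 (f v))
      (ballColouring (hypercube n) 1 χ v) (ballColouring (hypercube n) 1 ψ (f v))) :
    (∀ v, ψ (f v) = χ v) ∧ SameNeighborColours (hypercube n) ((hypercube n).comap f) χ := by
  have hcentre : ∀ v, ψ (f v) = χ v := by
    intro v
    obtain ⟨φ, hφ⟩ := hf v
    have h := hφ ⟨v, mem_ballVertices_one_iff.2 (Or.inr rfl)⟩
    simp only [ballColouring] at h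
    rwa [ballGraph_iso_centre hn φ] at h
  refine ⟨hcentre, fun v => ?_⟩
  obtain ⟨φ, hφ⟩ := hf v
  have hc := ballGraph_iso_centre hn φ
  ext c
  constructor
  · rintro ⟨x, hx, rfl⟩
    let x' : ballVertices (hypercube n) 1 v := ⟨x, mem_ballVertices_one_iff.2 (Or.inl hx)⟩
    have h1 : (ballGraph (hypercube n) 1 v).Adj
        ⟨v, mem_ballVertices_one_iff.2 (Or.inr rfl)⟩ x' := hx
    have h2 : (hypercube n).Adj _ _ := φ.map_rel_iff.2 h1
    change (hypercube n).Adj (φ _ : Fin n → Bool) (φ x' : Fin n → Bool) at h2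
    rw [hc] at h2
    refine ⟨f.symm (φ x'), ?_, ?_⟩
    · simpa using h2
    · rw [← hcentre, Equiv.apply_symm_apply]
      exact hφ x'
  · rintro ⟨x, hx, rfl⟩
    have hx' : (hypercube n).Adj (f v) (f x) := hx
    let y : ballVertices (hypercube n) 1 (f v) := ⟨f x, mem_ballVertices_one_iff.2 (Or.inl hx')⟩
    have h2 : (ballGraph (hypercube n) 1 (f v)).Adj
        (φ ⟨v, mem_ballVertices_one_iff.2 (Or.inr rfl)⟩) (φ (φ.symm y)) := by
      rw [RelIso.apply_symm_apply]
      change (hypercube n).Adj (φ _ : Fin n → Bool) (f x)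
      rwa [hc]
    have h3 : (hypercube n).Adj v (φ.symm y) := φ.map_rel_iff.1 h2
    refine ⟨φ.symm y, h3, ?_⟩
    have h4 := hφ (φ.symm y)
    rw [RelIso.apply_symm_apply] at h4
    simp only [ballColouring, y] at h4
    rw [← h4, hcentre]

theorem IsZeroTwoGraph.comap {V : Type*} [Fintype V] {G : SimpleGraph V} [DecidableRel G.Adj]
    {n : ℕ} (hG : IsZeroTwoGraph G n) (f : V ≃ V) [DecidableRel (G.comap f).Adj] :
    IsZeroTwoGraph (G.comap f) n where
  card_neighborFinset v := by
    rw [← hG.card_neighborFinset (f v)]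
    refine Finset.card_equiv f fun x => ?_
    simp
  eq_of_common u v x y z huv h1 h2 h3 h4 h5 h6 hxz hyz :=
    f.injective (hG.eq_of_common (f u) (f v) (f x) (f y) (f z) (f.injective.ne huv) h1 h2 h3 h4 h5
      h6 (f.injective.ne hxz) (f.injective.ne hyz))
  exists_common u v w hvw h1 h2 := by
    obtain ⟨u', h3, h4, h5⟩ := hG.exists_common (f u) (f v) (f w) (f.injective.ne hvw) h1 h2
    refine ⟨f.symm u', fun h => h3 ?_, ?_, ?_⟩
    · rw [← h, Equiv.apply_symm_apply]
    · simpa using h4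
    · simpa using h5

theorem distinguishable_of_not_hasRepeats {n : ℕ} [DecidableRel (hypercube n).Adj] {C : Type*}
    {χ : (Fin n → Bool) → C} (hn : 60 ≤ n)
    (hrep : ∀ U : Finset (Fin n → Bool), U.card = n → ¬ HasRepeats χ
      (U.biUnion fun w => (hypercube n).neighborFinset w)
      (U.biUnion fun w => (hypercube n).neighborFinset w) (n ^ 2 / 21600))
    (hrep' : ∀ t u, ¬ HasRepeats χ
      (((hypercube n).neighborFinset t).biUnion fun w => (hypercube n).neighborFinset w)
      ((hypercube n).neighborFinset u) (n / 2)) :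
    Distinguishable (hypercube n) 1 χ := by
  classical
  rintro ψ ⟨f, hf⟩
  obtain ⟨hcentre, hχ⟩ := sameNeighborColours_comap (by omega) hf
  have hG := hypercube_isZeroTwoGraph n
  have hH := hG.comap f
  have hle : ∀ v u, ((hypercube n).comap f).Adj v u → (hypercube n).Adj v u := fun v u h =>
    adj_of_not_hasRepeats hG hH hχ hn hrep hrep' h
  have heq : ∀ v, ((hypercube n).comap f).neighborFinset v = (hypercube n).neighborFinset v := by
    intro v
    refine Finset.eq_of_subset_of_card_le (fun u hu => ?_) ?_
    · rw [SimpleGraph.mem_neighborFinset] at hu ⊢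
      exact hle v u hu
    · rw [hG.card_neighborFinset, hH.card_neighborFinset]
  refine ⟨⟨f, fun {v u} => ?_⟩, hcentre⟩
  have := Finset.ext_iff.1 (heq v) u
  rw [SimpleGraph.mem_neighborFinset, SimpleGraph.mem_neighborFinset] at this
  exact this

/-! ### The limit -/

/-- The exponent is such that `n ^ (log n) ^ (-1/2) = exp (√(log n))`, which exceeds any
constant. -/
theorem eventually_mul_sq_le {q : ℕ → ℕ}
    (hq : ∀ᶠ n : ℕ in atTop,
      (n : ℝ) ^ (2 + 1 * (Real.log (n : ℝ)) ^ (-(1 / 2) : ℝ)) ≤ (q n : ℝ)) (M : ℕ) :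
    ∀ᶠ n : ℕ in atTop, M * n ^ 2 ≤ q n := by
  have hlog : Tendsto (fun n : ℕ => (Real.log (n : ℝ)) ^ (1 / 2 : ℝ)) atTop atTop :=
    (tendsto_rpow_atTop (by norm_num)).comp
      (Real.tendsto_log_atTop.comp tendsto_natCast_atTop_atTop)
  have hexp := (Real.tendsto_exp_atTop.comp hlog).eventually_ge_atTop (M : ℝ)
  filter_upwards [hq, hexp, eventually_ge_atTop 2] with n hn hM hn2
  have hn0 : (0 : ℝ) < n := by positivity
  have hl : 0 < Real.log n := Real.log_pos (by exact_mod_cast hn2)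
  have key : (n : ℝ) ^ (2 + 1 * (Real.log (n : ℝ)) ^ (-(1 / 2) : ℝ)) =
      (n : ℝ) ^ 2 * Real.exp ((Real.log (n : ℝ)) ^ (1 / 2 : ℝ)) := by
    rw [Real.rpow_add hn0, Real.rpow_two, Real.rpow_def_of_pos hn0 (1 * _), one_mul]
    congr 2
    nth_rewrite 1 [← Real.rpow_one (Real.log n)]
    rw [← Real.rpow_add hl]
    norm_num
  rw [key] at hn
  have : ((M * n ^ 2 : ℕ) : ℝ) ≤ q n := by
    push_cast
    calc (M : ℝ) * n ^ 2 = n ^ 2 * M := mul_comm _ _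
      _ ≤ n ^ 2 * Real.exp ((Real.log (n : ℝ)) ^ (1 / 2 : ℝ)) := by
        gcongr
        exact hM
      _ ≤ q n := hn
  exact_mod_cast this

theorem div_two_mul_pow_le {a c L r : ℕ} (h : a ≤ c * L ^ r) :
    (a : ENNReal) / ((2 * L : ℕ) : ENNReal) ^ r ≤ c * (2⁻¹ : ENNReal) ^ r := by
  refine ENNReal.div_le_of_le_mul ?_
  have h1 : (2⁻¹ : ENNReal) ^ r * 2 ^ r = 1 := by
    rw [← mul_pow, ENNReal.inv_mul_cancel two_ne_zero ENNReal.ofNat_ne_top, one_pow]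
  have h2 : (c : ENNReal) * 2⁻¹ ^ r * ((2 * L : ℕ) : ENNReal) ^ r = c * (L : ENNReal) ^ r := by
    push_cast
    rw [mul_pow, mul_assoc, ← mul_assoc (2⁻¹ ^ r), h1, one_mul]
  rw [h2]
  exact_mod_cast h

theorem exists_pow_le_pow_succ {k : ℕ} (hk : 3 ≤ k) :
    ∃ L : ℕ, 64 ≤ L ∧ ∀ m r, m ≤ k * (r + 1) → 4 ^ m ≤ L ^ (r + 1) := by
  refine ⟨4 ^ k, ?_, fun m r h => ?_⟩
  · calc 64 = 4 ^ 3 := by norm_num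
      _ ≤ 4 ^ k := Nat.pow_le_pow_right (by norm_num) hk
  · rw [← pow_mul]
    exact Nat.pow_le_pow_right (by norm_num) h

theorem tendsto_one_sub_geometric {L : ℕ} :
    Tendsto (fun n : ℕ => 1 - ((L : ENNReal) * (2⁻¹ : ENNReal) ^ (n ^ 2 / 21600) +
      8 * (2⁻¹ : ENNReal) ^ (n / 2))) atTop (𝓝 1) := by
  have h0 : Tendsto (fun r : ℕ => (2⁻¹ : ENNReal) ^ r) atTop (𝓝 0) :=
    ENNReal.tendsto_pow_atTop_nhds_zero_of_lt_one (by norm_num)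
  have h1 : Tendsto (fun n : ℕ => n ^ 2 / 21600) atTop atTop :=
    (Nat.tendsto_div_const_atTop (by norm_num)).comp (tendsto_pow_atTop two_ne_zero)
  have h2 : Tendsto (fun n : ℕ => n / 2) atTop atTop := Nat.tendsto_div_const_atTop (by norm_num)
  have h3 := (ENNReal.Tendsto.const_mul (a := (L : ENNReal)) (h0.comp h1)
    (Or.inr (ENNReal.natCast_ne_top L))).add
    (ENNReal.Tendsto.const_mul (a := 8) (h0.comp h2) (Or.inr ENNReal.ofNat_ne_top))
  have h4 := ENNReal.Tendsto.sub (tendsto_const_nhds (x := (1 : ENNReal))) h3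
    (Or.inl ENNReal.one_ne_top)
  simpa using h4

theorem theorem1p5 :
    ∃ K : ℝ, 0 < K ∧ ∀ q : ℕ → ℕ,
      (∀ᶠ n : ℕ in atTop,
        (n : ℝ) ^ (2 + K * (Real.log (n : ℝ)) ^ (-(1 / 2) : ℝ)) ≤ (q n : ℝ)) →
      Tendsto
        (fun n : ℕ => randomColouring n (q n) {χ | Distinguishable (hypercube n) 1 χ})
        atTop (𝓝 1) := by
  classical
  refine ⟨1, one_pos, fun q hq => ?_⟩
  obtain ⟨L, hL64, hL⟩ := exists_pow_le_pow_succ (k := 21600) (by norm_num)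
  have hL0 : 0 < L := by omega
  have hbound : ∀ᶠ n : ℕ in atTop,
      1 - ((L : ENNReal) * (2⁻¹ : ENNReal) ^ (n ^ 2 / 21600) + 8 * (2⁻¹ : ENNReal) ^ (n / 2)) ≤
        randomColouring n (q n) {χ | Distinguishable (hypercube n) 1 χ} := by
    filter_upwards [eventually_mul_sq_le hq (2 * L), eventually_ge_atTop 60] with n hqn hn
    have hq0 : 0 < q n := lt_of_lt_of_le (by positivity) hqn
    have := isProbabilityMeasure_randomColouring n hq0
    have hbad := randomColouring_exists_hasRepeats_le hq0 (M := 2 * L) (by positivity) hqn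
      (n ^ 2 / 21600) (n / 2)
    have h1 : (4 : ENNReal) ^ n ^ 2 / ((2 * L : ℕ) : ENNReal) ^ (n ^ 2 / 21600) ≤
        L * (2⁻¹ : ENNReal) ^ (n ^ 2 / 21600) := by
      have := div_two_mul_pow_le (a := 4 ^ n ^ 2) (c := L) (r := n ^ 2 / 21600) (by
        rw [← pow_succ']
        exact hL _ _ (by omega))
      exact_mod_cast this
    have h2 : (8 : ENNReal) ^ n / ((2 * L : ℕ) : ENNReal) ^ (n / 2) ≤
        8 * (2⁻¹ : ENNReal) ^ (n / 2) := by
      have := div_two_mul_pow_le (a := 8 ^ n) (c := 8) (r := n / 2) (by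
        calc 8 ^ n ≤ 8 ^ (1 + 2 * (n / 2)) := Nat.pow_le_pow_right (by norm_num) (by omega)
          _ = 8 * 64 ^ (n / 2) := by rw [pow_add, pow_mul]; norm_num
          _ ≤ 8 * L ^ (n / 2) := Nat.mul_le_mul_left _ (Nat.pow_le_pow_left hL64 _))
      exact_mod_cast this
    rw [tsub_le_iff_right, ← measure_univ (μ := randomColouring n (q n))]
    refine (measure_mono fun χ _ => ?_).trans ((measure_union_le _ _).trans
      (add_le_add_right (hbad.trans (add_le_add h1 h2)) _))
    by_cases h : χ ∈ {χ : (Fin n → Bool) → Fin (q n) | Distinguishable (hypercube n) 1 χ}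
    · exact Or.inl h
    · refine Or.inr ?_
      by_contra hno
      refine h (distinguishable_of_not_hasRepeats hn (fun U hU hr => hno (Or.inl ⟨U, hU, hr⟩))
        fun t u hr => hno (Or.inr ⟨t, u, hr⟩))
  have hle : ∀ᶠ n : ℕ in atTop,
      randomColouring n (q n) {χ | Distinguishable (hypercube n) 1 χ} ≤ 1 := by
    filter_upwards [eventually_mul_sq_le hq 1, eventually_ge_atTop 1] with n hqn hn
    have := isProbabilityMeasure_randomColouring n (q := q n)
      (lt_of_lt_of_le (by positivity) hqn)
    exact prob_le_one
  exact tendsto_of_tendsto_of_tendsto_of_le_of_le' tendsto_one_sub_geometric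
    tendsto_const_nhds hbound hle
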